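/- Let $d>1$ be an integer and let $\mathcal F$ be a foliation of degree $d$ on $\mathbb P^2_{\mathbb C}$, given by a non-zero $1$-form $\omega=A\,dx+B\,dy+C\,dz$ where $A,B,C\in\mathbb C[x,y,z]$ are homogeneous of degree $d+1$, $Ax+By+Cz=0$, and $A,B,C$ have only finitely many common zeros in $\mathbb P^2_{\mathbb C}$. Let $\mathbb Z[\mathcal F]\subset\mathbb C$ be the subring generated by all coefficients of $A,B,C$. For a maximal ideal $\mathfrak p$ of $\mathbb Z[\mathcal F]$, with (finite) residue field $\mathbb F_{\mathfrak p}$ of characteristic $p$, let $\omega_{\mathfrak p}=A_{\mathfrak p}dx+B_{\mathfrak p}dy+C_{\mathfrak p}dz$ be the $1$-form over $\overline{\mathbb F}_{\mathfrak p}$ obtained by reducing the coefficients of $\omega$ modulo $\mathfrak p$, and let $\mathcal F_{\mathfrak p}$ be the foliation defined by it. If $p\nmid d+2$, write $d\omega_{\mathfrak p}=(d+2)(L\,dy\wedge dz-M\,dx\wedge dz+N\,dx\wedge dy)$ and $v=L\partial_x+M\partial_y+N\partial_z$, and let $v^p$ be the $p$-th iterate of the derivation $v$. We say that $\mathcal F_{\mathfrak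 p}$ has irreducible $p$-divisor if $p\nmid d+2$ and the polynomial $$i_{v^p}\omega_{\mathfrak p}=A_{\mathfrak p}v^p(x)+B_{\mathfrak p}v^p(y)+C_{\mathfrak p}v^p(z)$$ is irreducible in $\overline{\mathbb F}_{\mathfrak p}[x,y,z]$ (in particular non-zero, that is, $\mathcal F_{\mathfrak p}$ is not $p$-closed). Suppose that $\mathcal F_{\mathfrak p}$ has irreducible $p$-divisor for infinitely many primes $\mathfrak p$, in the sense that this holds for all $\mathfrak p$ in some Zariski-dense subset of the maximal spectrum of $\mathbb Z[\mathcal F]$. Then $\mathcal F$ has no algebraic solutions: there is no irreducible homogeneous polynomial $F\in\mathbb C[x,y,z]$ such that $dF\wedge\omega=F\,\Theta$ for some $2$-form $\Theta$ whose coefficients are homogeneous polynomials of degree $d$. -/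

import Mathlib

open MvPolynomial

namespace PlaneFoliation

noncomputable section

/-- The coordinate ring `k[x, y, z]` of affine three-space; `x, y, z` are `X 0, X 1, X 2`. -/
abbrev Poly (k : Type*) [CommRing k] : Type _ := MvPolynomial (Fin 3) k

/-- Polynomial `1`-forms `A dx + B dy + C dz` on affine three-space, as triples `(A, B, C)`. -/
abbrev OneForm (k : Type*) [CommRing k] : Type _ := Fin 3 → Poly k

/-- Polynomial `2`-forms `L dy∧dz + M dz∧dx + N dx∧dy` on affine three-space,
as triples `(L, M, N)`. -/
abbrev TwoForm (k : Type*) [CommRing k] : Type _ := Fin 3 → Poly k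

/-- The differential `dF` of a polynomial. -/
def differential {k : Type*} [CommRing k] (F : Poly k) : OneForm k :=
  fun i => pderiv i F

/-- The exterior product of two `1`-forms. -/
def wedge {k : Type*} [CommRing k] (α β : OneForm k) : TwoForm k :=
  ![α 1 * β 2 - α 2 * β 1, α 2 * β 0 - α 0 * β 2, α 0 * β 1 - α 1 * β 0]

/-- The exterior derivative of a `1`-form. -/
def extDeriv {k : Type*} [CommRing k] (ω : OneForm k) : TwoForm k :=
  ![pderiv 1 (ω 2) - pderiv 2 (ω 1), pderiv 2 (ω 0) - pderiv 0 (ω 2),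
    pderiv 0 (ω 1) - pderiv 1 (ω 0)]

/-- `ω = A dx + B dy + C dz` defines a foliation of degree `d` on the projective plane over
the field `k` (algebraically closed in all uses): `A, B, C` are homogeneous of degree `d + 1`,
`A x + B y + C z = 0`, `ω` is not zero, and its zero locus in the projective plane is finite. -/
structure IsFoliation {k : Type*} [Field k] (d : ℕ) (ω : OneForm k) : Prop where
  isHomogeneous : ∀ i, (ω i).IsHomogeneous (d + 1)
  contract_radial : ∑ i, ω i * X i = 0
  ne_zero : ω ≠ 0
  finite_sing : {P : Projectivization k (Fin 3 → k) | ∀ i, eval P.rep (ω i) = 0}.Finite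

/-- The curve `{F = 0}` is invariant by the foliation of degree `d` defined by `ω`:
`dF ∧ ω = F Θ` for a homogeneous `2`-form `Θ` (its coefficients have degree `d`, by comparison
of degrees). -/
def IsInvariant {k : Type*} [Field k] (d : ℕ) (ω : OneForm k) (F : Poly k) : Prop :=
  ∃ Θ : TwoForm k, (∀ i, (Θ i).IsHomogeneous d) ∧
    ∀ i, wedge (differential F) ω i = F * Θ i

/-- The foliation of degree `d` defined by `ω` has an algebraic solution: an irreducible algebraic
curve in the projective plane, given by an irreducible homogeneous polynomial, which is
invariant. -/
def HasAlgebraicSolution {k : Type*} [Field k] (d : ℕ) (ω : OneForm k) : Prop :=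
  ∃ (e : ℕ) (F : Poly k), F.IsHomogeneous e ∧ Irreducible F ∧ IsInvariant d ω F

/-- The vector field `v_ω = L ∂_x + M ∂_y + N ∂_z`, as a derivation of `k[x, y, z]`, where
`dω = (d + 2) (L dy∧dz + M dz∧dx + N dx∧dy)`. It is meaningful when `d + 2 ≠ 0` in `k`. -/
def vectorField {k : Type*} [Field k] (d : ℕ) (ω : OneForm k) : Derivation k (Poly k) (Poly k) :=
  mkDerivation k fun i => C ((d + 2 : k)⁻¹) * extDeriv ω i

/-- The polynomial `i_{v_ω^p} ω = A v_ω^p(x) + B v_ω^p(y) + C v_ω^p(z)`, where `p` is the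
characteristic of `k` and `v_ω^p` is the `p`-fold iterate of the derivation `v_ω`.  The foliation
is `p`-closed when this is zero; otherwise it is the equation of the `p`-divisor. -/
def pDivisorEquation {k : Type*} [Field k] (d : ℕ) (ω : OneForm k) : Poly k :=
  ∑ i, ω i * (⇑(vectorField d ω))^[ringChar k] (X i)

/-- The foliation of degree `d` defined by `ω`, over an algebraically closed field of positive
characteristic `p`, has irreducible `p`-divisor: `p` does not divide `d + 2`, so that the
`p`-divisor is defined, and the homogeneous equation `i_{v_ω^p} ω` of the `p`-divisor is an
irreducible polynomial (so in particular the foliation is not `p`-closed). -/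
def HasIrreduciblePDivisor {k : Type*} [Field k] (d : ℕ) (ω : OneForm k) : Prop :=
  ¬ ringChar k ∣ d + 2 ∧ Irreducible (pDivisorEquation d ω)

/-- The ring `ℤ[ω]` generated by the coefficients of the complex `1`-form `ω`. -/
def coeffRing (ω : OneForm ℂ) : Subalgebra ℤ ℂ :=
  Algebra.adjoin ℤ {c : ℂ | ∃ (i : Fin 3) (m : Fin 3 →₀ ℕ), c = coeff m (ω i)}

theorem coeff_mem_coeffRing (ω : OneForm ℂ) (i : Fin 3) (m : Fin 3 →₀ ℕ) :
    coeff m (ω i) ∈ coeffRing ω :=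
  Algebra.subset_adjoin ⟨i, m, rfl⟩

/-- The form `ω`, regarded as a form with coefficients in `ℤ[ω]`. -/
def integralModel (ω : OneForm ℂ) : OneForm (coeffRing ω) :=
  fun i => ∑ m ∈ (ω i).support, monomial m ⟨coeff m (ω i), coeff_mem_coeffRing ω i m⟩

theorem map_integralModel (ω : OneForm ℂ) (i : Fin 3) :
    map (coeffRing ω).val.toRingHom (integralModel ω i) = ω i := by
  conv_rhs => rw [(ω i).as_sum]
  simp [integralModel, map_sum, map_monomial]

/-- The residue field `ℤ[ω] / 𝔭` of a maximal ideal `𝔭`. -/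
abbrev ResField {R : Type*} [CommRing R] (𝔭 : MaximalSpectrum R) : Type _ := R ⧸ 𝔭.asIdeal

instance instFieldResField {R : Type*} [CommRing R] (𝔭 : MaximalSpectrum R) :
    Field (ResField 𝔭) :=
  haveI := 𝔭.isMaximal
  Ideal.Quotient.field 𝔭.asIdeal

/-- The reduction modulo `𝔭` of `ω`, a form over the algebraic closure of `ℤ[ω] / 𝔭`. -/
def reduction (ω : OneForm ℂ) (𝔭 : MaximalSpectrum (coeffRing ω)) :
    OneForm (AlgebraicClosure (ResField 𝔭)) :=
  fun i => map ((algebraMap (ResField 𝔭) (AlgebraicClosure (ResField 𝔭))).comp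
    (Ideal.Quotient.mk 𝔭.asIdeal)) (integralModel ω i)

/-- A property of maximal ideals holds for infinitely many primes: it holds at all points of some
Zariski dense subset of the maximal spectrum. -/
def ForInfinitelyManyPrimes {R : Type*} [CommRing R] (P : MaximalSpectrum R → Prop) : Prop :=
  ∃ S : Set (MaximalSpectrum R), Dense S ∧ ∀ 𝔪 ∈ S, P 𝔪

end

end PlaneFoliation

/-! An invariant curve of degree `e` spreads out: over a finitely generated extension of `ℤ[ω]`,
Chevalley's theorem gives a nonzero invariant curve `G` of degree `e` modulo every `𝔭` in a nonempty
open set (`exists_invariant_reduction`). As `ℤ[ω]` is Jacobson, some such `𝔭` has irreducible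
`p`-divisor and `e < p`.

In characteristic `p`, let `P = i_{v^p} ω`. Since `v`, `v^p` and the radial field all map `G` into
`(G)`, and `P` is the determinant of the three, Cramer's rule gives `G ∣ P * ∂_j G`
(`dvd_pDivisorEquation_mul_pderiv`). Now `P` is prime, of degree `p(d-1) + d + 2 > e`, so it
cancels: `G ∣ ∂_j G`, and hence `∂_j G = 0` by degree. Euler's identity gives `e G = 0`, impossible
for `0 < e < p`. Irreducibility of `G` is never needed. -/

/-! ### Iterates of derivations -/

namespace Derivation

/-- The general Leibniz rule for iterates of a derivation of a commutative algebra. -/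
theorem iterate_mul {k A : Type*} [CommRing k] [CommRing A] [Algebra k A] (D : Derivation k A A)
    (n : ℕ) (a b : A) :
    D^[n] (a * b) =
      ∑ ij ∈ Finset.HasAntidiagonal.antidiagonal n, n.choose ij.1 • (D^[ij.1] a * D^[ij.2] b) := by
  induction n with
  | zero => simp
  | succ n ih =>
    rw [Finset.sum_antidiagonal_choose_succ_nsmul (fun i j => D^[i] a * D^[j] b) n]
    simp only [Function.iterate_succ_apply', ih, map_sum, map_nsmul, leibniz, smul_eq_mul,
      nsmul_add, Finset.sum_add_distrib, add_right_inj]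
    refine Finset.sum_congr rfl fun ⟨i, j⟩ hij ↦ ?_
    rw [n.choose_symm_of_eq_add (Finset.HasAntidiagonal.mem_antidiagonal.1 hij).symm, mul_comm]

/-- The intermediate binomial coefficients in the Leibniz rule are divisible by `p`. -/
theorem iterate_char_mul {k A : Type*} [CommRing k] [CommRing A] [Algebra k A]
    (D : Derivation k A A) (p : ℕ) [hp : Fact p.Prime] [CharP A p] (a b : A) :
    D^[p] (a * b) = a * D^[p] b + b * D^[p] a := by
  have hne : ((0, p) : ℕ × ℕ) ≠ (p, 0) := by simp [hp.out.ne_zero]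
  rw [iterate_mul, ← Finset.sum_subset (s₁ := {(0, p), (p, 0)}), Finset.sum_pair hne]
  · simp [mul_comm]
  · intro x hx
    simp only [Finset.mem_insert, Finset.mem_singleton] at hx
    rcases hx with rfl | rfl <;> simp
  · rintro ⟨i, j⟩ hij hx
    rw [Finset.HasAntidiagonal.mem_antidiagonal] at hij
    simp only [Finset.mem_insert, Finset.mem_singleton, Prod.mk.injEq, not_or] at hx hij
    have h : p ∣ p.choose i := hp.out.dvd_choose_self (by omega) (by omega)
    rw [nsmul_eq_mul, (CharP.cast_eq_zero_iff A p _).2 h, zero_mul]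

/-- In characteristic `p`, the `p`-fold iterate of a derivation is a derivation. -/
noncomputable def iterateChar {k A : Type*} [CommRing k] [CommRing A] [Algebra k A]
    (D : Derivation k A A) (p : ℕ) [Fact p.Prime] [CharP A p] : Derivation k A A :=
  Derivation.mk' (D.toLinearMap ^ p) fun a b => by
    simpa [Module.End.pow_apply] using D.iterate_char_mul p a b

theorem iterateChar_apply {k A : Type*} [CommRing k] [CommRing A] [Algebra k A]
    (D : Derivation k A A) (p : ℕ) [Fact p.Prime] [CharP A p] (a : A) :
    D.iterateChar p a = D^[p] a := by
  simp [iterateChar, Module.End.pow_apply]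

theorem dvd_iterate {k A : Type*} [CommRing k] [CommRing A] [Algebra k A]
    (D : Derivation k A A) {a : A} (h : a ∣ D a) {n : ℕ} (hn : n ≠ 0) : a ∣ D^[n] a := by
  obtain ⟨n, rfl⟩ := Nat.exists_eq_succ_of_ne_zero hn
  clear hn
  induction n with
  | zero => simpa using h
  | succ n ih =>
    rw [Function.iterate_succ_apply']
    obtain ⟨c, hc⟩ := ih
    rw [hc, leibniz]
    exact dvd_add (dvd_mul_right _ _) (Dvd.dvd.mul_left h _)

end Derivation

/-! ### Polynomial derivations, homogeneity and divisibility -/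

namespace MvPolynomial

theorem mkDerivation_eq_sum {k σ : Type*} [CommRing k] [Fintype σ]
    (D : Derivation k (MvPolynomial σ k) (MvPolynomial σ k)) (F : MvPolynomial σ k) :
    D F = ∑ i, D (X i) * pderiv i F := by
  classical
  have hsum (G : MvPolynomial σ k) :
      (∑ i, D (X i) • pderiv i : Derivation k (MvPolynomial σ k) (MvPolynomial σ k)) G =
        ∑ i, D (X i) * pderiv i G := by
    rw [← Derivation.coeFn_coe]
    exact (congrFun (map_sum Derivation.coeFnAddMonoidHom
      (fun i => D (X i) • pderiv i) Finset.univ) G).trans (Finset.sum_apply _ _ _)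
  rw [← hsum]
  congr 1
  refine MvPolynomial.derivation_ext fun j => ?_
  rw [hsum]
  simp [pderiv_X, Pi.single_apply]

theorem IsHomogeneous.derivation {k σ : Type*} [CommRing k] [Fintype σ]
    {D : Derivation k (MvPolynomial σ k) (MvPolynomial σ k)} {t m : ℕ}
    (hD : ∀ i, (D (X i)).IsHomogeneous (t + 1)) {F : MvPolynomial σ k}
    (hF : F.IsHomogeneous (m + 1)) : (D F).IsHomogeneous (t + m + 1) := by
  rw [mkDerivation_eq_sum]
  refine IsHomogeneous.sum _ _ _ fun i _ => ?_
  have := (hD i).mul (hF.pderiv (i := i))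
  convert this using 1
  omega

theorem IsHomogeneous.derivation_iterate_X {k σ : Type*} [CommRing k] [Fintype σ]
    {D : Derivation k (MvPolynomial σ k) (MvPolynomial σ k)} {t : ℕ}
    (hD : ∀ i, (D (X i)).IsHomogeneous (t + 1)) (n : ℕ) (i : σ) :
    (D^[n] (X i)).IsHomogeneous (n * t + 1) := by
  induction n with
  | zero => simpa using isHomogeneous_X k i
  | succ n ih =>
    rw [Function.iterate_succ_apply']
    convert ih.derivation hD using 1
    ring

theorem dvd_of_dvd_X_mul {k σ : Type*} [Field k] {F g : MvPolynomial σ k} {i j : σ} (hij : i ≠ j)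
    (hF : F ≠ 0) (hi : F ∣ X i * g) (hj : F ∣ X j * g) : F ∣ g := by
  obtain ⟨a, ha⟩ := hi
  obtain ⟨b, hb⟩ := hj
  have hab : X j * a = X i * b := mul_left_cancel₀ hF (by linear_combination X i * hb - X j * ha)
  have hX : Prime (X i : MvPolynomial σ k) := X_prime
  obtain ⟨c, rfl⟩ : X i ∣ a := by
    refine (hX.dvd_or_dvd ⟨b, hab⟩).resolve_left fun h => hij ?_
    exact X_dvd_X.1 h
  exact ⟨c, mul_left_cancel₀ hX.ne_zero (by linear_combination ha)⟩

theorem not_dvd_of_isHomogeneous_of_lt {k σ : Type*} [Field k] {F G : MvPolynomial σ k} {m n : ℕ}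
    (hF : F.IsHomogeneous m) (hG : G.IsHomogeneous n) (hG0 : G ≠ 0) (h : n < m) : ¬ F ∣ G := by
  intro hd
  have hF0 : F ≠ 0 := ne_zero_of_dvd_ne_zero hG0 hd
  have := totalDegree_le_of_dvd_of_isDomain hd hG0
  rw [hF.totalDegree hF0, hG.totalDegree hG0] at this
  omega

end MvPolynomial

/-! ### Invariant curves and the `p`-divisor -/

namespace PlaneFoliation

variable {K : Type*} [Field K] {d : ℕ} {ω : OneForm K}

theorem vectorField_X (i : Fin 3) :
    vectorField d ω (X i) = C ((d + 2 : K)⁻¹) * extDeriv ω i := by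
  simp [vectorField]

theorem isHomogeneous_extDeriv (hω : ∀ i, (ω i).IsHomogeneous (d + 1)) (i : Fin 3) :
    (extDeriv ω i).IsHomogeneous d := by
  fin_cases i <;> exact ((hω _).pderiv).sub (hω _).pderiv

theorem isHomogeneous_vectorField_X (hω : ∀ i, (ω i).IsHomogeneous (d + 1)) (i : Fin 3) :
    (vectorField d ω (X i)).IsHomogeneous d := by
  rw [vectorField_X]
  simpa using (isHomogeneous_C _ _).mul (isHomogeneous_extDeriv hω i)

theorem isHomogeneous_pDivisorEquation {t : ℕ} {ω : OneForm K}
    (hω : ∀ i, (ω i).IsHomogeneous (t + 1 + 1)) :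
    (pDivisorEquation (t + 1) ω).IsHomogeneous (t + 1 + 1 + (ringChar K * t + 1)) :=
  IsHomogeneous.sum _ _ _ fun i _ =>
    (hω i).mul (IsHomogeneous.derivation_iterate_X (isHomogeneous_vectorField_X hω) _ i)

/-- The vector field `v_ω` and the radial vector field determine the form. -/
theorem wedge_vectorField_X (hω : ∀ i, (ω i).IsHomogeneous (d + 1))
    (hr : ∑ i, ω i * X i = 0) (hd : (d + 2 : K) ≠ 0) :
    ω = wedge (fun i => vectorField d ω (X i)) X := by
  have hC : C ((d + 2 : K)⁻¹) * (d + 2 : Poly K) = 1 := by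
    have : (d + 2 : Poly K) = C (d + 2 : K) := by simp [map_ofNat]
    rw [this, ← C_mul, inv_mul_cancel₀ hd, C_1]
  -- Cartan's formula in coordinates: `d(i_R ω) = 0` and Euler's identity give `i_R dω = (d + 2) ω`
  -- for the radial field `R`. Euler contributes `d + 1`, the derivative of `X j` the remaining `1`.
  have hD (j : Fin 3) : ∑ i, (ω i * pderiv j (X i) + X i * pderiv j (ω i)) = 0 := by
    simpa using congrArg (pderiv j) hr
  have h0 := hD 0
  have h1 := hD 1
  have h2 := hD 2
  have e0 := (hω 0).sum_X_mul_pderiv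
  have e1 := (hω 1).sum_X_mul_pderiv
  have e2 := (hω 2).sum_X_mul_pderiv
  simp [Fin.sum_univ_three, pderiv_X, Pi.single_apply] at h0 h1 h2 e0 e1 e2
  funext i
  simp only [wedge, vectorField_X, extDeriv]
  fin_cases i <;> simp
  · linear_combination (-ω 0) * hC + C ((d + 2 : K)⁻¹) * (h0 - e0)
  · linear_combination (-ω 1) * hC + C ((d + 2 : K)⁻¹) * (h1 - e1)
  · linear_combination (-ω 2) * hC + C ((d + 2 : K)⁻¹) * (h2 - e2)

/-- Substituting `ω = v ∧ R` and expanding the double cross product gives `dF ∧ ω = e F v - v(F) R`.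
So `F` divides `X 0 * v F` and `X 1 * v F`, and these two variables are coprime. -/
theorem dvd_vectorField {e : ℕ} {F : Poly K} (hF : F.IsHomogeneous e) (hF0 : F ≠ 0)
    (hω : ∀ i, (ω i).IsHomogeneous (d + 1)) (hr : ∑ i, ω i * X i = 0) (hd : (d + 2 : K) ≠ 0)
    (hinv : ∀ i, F ∣ wedge (differential F) ω i) : F ∣ vectorField d ω F := by
  have eul := hF.sum_X_mul_pderiv
  have hv := mkDerivation_eq_sum (vectorField d ω) F
  have hw := wedge_vectorField_X hω hr hd
  set v := vectorField d ω
  have w0 := congrFun hw 0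
  have w1 := congrFun hw 1
  have w2 := congrFun hw 2
  simp [wedge] at w0 w1 w2
  simp [Fin.sum_univ_three] at eul hv
  have h0 : X 0 * v F = F * ((e : Poly K) * v (X 0)) - wedge (differential F) ω 0 := by
    simp [wedge, differential, w0, w1, w2]
    linear_combination X 0 * hv + v (X 0) * eul
  have h1 : X 1 * v F = F * ((e : Poly K) * v (X 1)) - wedge (differential F) ω 1 := by
    simp [wedge, differential, w0, w1, w2]
    linear_combination X 1 * hv + v (X 1) * eul
  refine dvd_of_dvd_X_mul (i := 0) (j := 1) (by decide) hF0 ?_ ?_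
  · exact h0 ▸ dvd_sub (dvd_mul_right _ _) (hinv 0)
  · exact h1 ▸ dvd_sub (dvd_mul_right _ _) (hinv 1)

/-- The `p`-divisor of a foliation contains an invariant curve `F`, up to the factor `∂F`. -/
theorem dvd_pDivisorEquation_mul_pderiv [hp : Fact (ringChar K).Prime] {e : ℕ} {F : Poly K}
    (hF : F.IsHomogeneous e) (hF0 : F ≠ 0)
    (hω : ∀ i, (ω i).IsHomogeneous (d + 1)) (hr : ∑ i, ω i * X i = 0) (hd : (d + 2 : K) ≠ 0)
    (hinv : ∀ i, F ∣ wedge (differential F) ω i) (j : Fin 3) :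
    F ∣ pDivisorEquation d ω * pderiv j F := by
  have eul := hF.sum_X_mul_pderiv
  obtain ⟨a, ha⟩ := dvd_vectorField hF hF0 hω hr hd hinv
  obtain ⟨b, hb⟩ := (vectorField d ω).dvd_iterate ⟨a, ha⟩ hp.out.ne_zero
  have hv := mkDerivation_eq_sum (vectorField d ω) F
  have hvp := mkDerivation_eq_sum ((vectorField d ω).iterateChar (ringChar K)) F
  simp only [Derivation.iterateChar_apply, hb] at hvp
  rw [ha] at hv
  have hw := wedge_vectorField_X hω hr hd
  unfold pDivisorEquation
  set v := vectorField d ω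
  have w0 := congrFun hw 0
  have w1 := congrFun hw 1
  have w2 := congrFun hw 2
  simp [wedge] at w0 w1 w2
  simp [Fin.sum_univ_three] at eul hv hvp
  simp only [Fin.sum_univ_three, w0, w1, w2]
  generalize v^[ringChar K] (X 0) = y0 at *
  generalize v^[ringChar K] (X 1) = y1 at *
  generalize v^[ringChar K] (X 2) = y2 at *
  generalize v (X 0) = v0 at *
  generalize v (X 1) = v1 at *
  generalize v (X 2) = v2 at *
  -- With rows `y = v^p`, `v`, `X`, the `p`-divisor equation is a determinant, and the rows send the
  -- gradient of `F` to `b F`, `a F`, `e F`. The witnesses are Cramer's rule: cofactors of column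
  -- `j` weighted by `b`, `a`, `e`.
  fin_cases j <;> simp
  · exact ⟨b * (v1 * X 2 - v2 * X 1) + a * (X 1 * y2 - X 2 * y1) + (e : Poly K) * (y1 * v2 - y2 * v1), by
      linear_combination (-(v1 * X 2 - v2 * X 1)) * hvp - (X 1 * y2 - X 2 * y1) * hv
        + (y1 * v2 - y2 * v1) * eul⟩
  · exact ⟨b * (v2 * X 0 - v0 * X 2) + a * (X 2 * y0 - X 0 * y2) + (e : Poly K) * (y2 * v0 - y0 * v2), by
      linear_combination (-(v2 * X 0 - v0 * X 2)) * hvp - (X 2 * y0 - X 0 * y2) * hv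
        + (y2 * v0 - y0 * v2) * eul⟩
  · exact ⟨b * (v0 * X 1 - v1 * X 0) + a * (X 0 * y1 - X 1 * y0) + (e : Poly K) * (y0 * v1 - y1 * v0), by
      linear_combination (-(v0 * X 1 - v1 * X 0)) * hvp - (X 0 * y1 - X 1 * y0) * hv
        + (y0 * v1 - y1 * v0) * eul⟩

/-- In characteristic zero `ringChar` is `0`, the zeroth iterate is the identity, and the equation
degenerates to `i_R ω = 0`. -/
theorem HasIrreduciblePDivisor.prime_ringChar (h : HasIrreduciblePDivisor d ω)
    (hr : ∑ i, ω i * X i = 0) : (ringChar K).Prime := by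
  refine (CharP.char_is_prime_or_zero K (ringChar K)).resolve_right fun h0 => h.2.ne_zero ?_
  simpa [pDivisorEquation, h0] using hr

/-- A foliation with irreducible `p`-divisor has no invariant curve of positive degree smaller
than `p`. -/
theorem HasIrreduciblePDivisor.not_invariant (h : HasIrreduciblePDivisor d ω) (hd : 1 < d)
    (hω : ∀ i, (ω i).IsHomogeneous (d + 1)) (hr : ∑ i, ω i * X i = 0)
    {e : ℕ} (he : 0 < e) (hep : e < ringChar K) {F : Poly K} (hF : F.IsHomogeneous e)
    (hF0 : F ≠ 0) (hinv : ∀ i, F ∣ wedge (differential F) ω i) : False := by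
  have hp := h.prime_ringChar hr
  have : Fact (ringChar K).Prime := ⟨hp⟩
  have hd2 : (d + 2 : K) ≠ 0 := by
    intro h0
    exact h.1 ((ringChar.spec K (d + 2)).1 (by exact_mod_cast h0))
  have hnd : ¬ pDivisorEquation d ω ∣ F := by
    obtain ⟨t, rfl⟩ : ∃ t, d = t + 1 := ⟨d - 1, by omega⟩
    refine not_dvd_of_isHomogeneous_of_lt (isHomogeneous_pDivisorEquation hω) hF hF0 ?_
    -- Here `d > 1` enters: the degree is at least `p`, hence above `e`.
    have : ringChar K * 1 ≤ ringChar K * t := Nat.mul_le_mul_left _ (by omega)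
    omega
  have hz (j : Fin 3) : pderiv j F = 0 := by
    by_contra hj
    obtain ⟨q, hq⟩ := dvd_pDivisorEquation_mul_pderiv hF hF0 hω hr hd2 hinv j
    obtain ⟨r, rfl⟩ := (h.2.prime.dvd_or_dvd ⟨_, hq.symm⟩).resolve_left hnd
    refine not_dvd_of_isHomogeneous_of_lt hF (hF.pderiv (i := j)) hj (by omega) ⟨r, ?_⟩
    exact mul_left_cancel₀ h.2.ne_zero (by linear_combination hq)
  have eul := hF.sum_X_mul_pderiv
  simp only [hz, mul_zero, Finset.sum_const_zero, nsmul_eq_mul] at eul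
  have he0 : ((e : K)) = 0 := by
    have := (mul_eq_zero.1 eul.symm).resolve_right hF0
    rw [← map_natCast C, C_eq_zero] at this
    exact this
  exact absurd (Nat.le_of_dvd he ((ringChar.spec K e).1 he0)) (by omega)

end PlaneFoliation

/-! ### Chevalley's theorem and Jacobson rings -/

/-- A constructible set containing the generic point of the spectrum of a domain contains a
nonempty principal open set. -/
theorem PrimeSpectrum.exists_basicOpen_subset_of_isConstructible {R : Type*} [CommRing R]
    [IsDomain R] {s : Set (PrimeSpectrum R)} (hs : Topology.IsConstructible s)
    (h : (⟨⊥, Ideal.isPrime_bot⟩ : PrimeSpectrum R) ∈ s) :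
    ∃ f : R, f ≠ 0 ∧ (PrimeSpectrum.basicOpen f : Set (PrimeSpectrum R)) ⊆ s := by
  obtain ⟨T, rfl⟩ := PrimeSpectrum.exists_constructibleSetData_iff.2 hs
  simp only [ConstructibleSetData.toSet, Set.mem_iUnion] at h
  obtain ⟨c, hc, hg, hf⟩ := h
  refine ⟨c.f, by simpa [mem_zeroLocus] using hf, fun x hx => ?_⟩
  simp only [ConstructibleSetData.toSet, Set.mem_iUnion]
  refine ⟨c, hc, ?_, by simpa [mem_zeroLocus] using hx⟩
  rintro _ ⟨i, rfl⟩
  -- The generic point lies in the closed part of this piece, so all its equations vanish and the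
  -- piece is the open set `D(c.f)`.
  have : c.g i = 0 := by simpa using hg ⟨i, rfl⟩
  simp [this]

/-- For a finitely generated extension `R ⊆ S` of domains, all geometric points of `R` at maximal
ideals in some nonempty open set extend to `S`. -/
theorem exists_ne_zero_forall_exists_ringHom_algebraicClosure {R S : Type*} [CommRing R]
    [CommRing S] [IsDomain R] [IsDomain S] [IsNoetherianRing R] [Algebra R S]
    [FaithfulSMul R S] [Algebra.FiniteType R S] :
    ∃ f : R, f ≠ 0 ∧ ∀ 𝔭 : MaximalSpectrum R, f ∉ 𝔭.asIdeal →
      ∃ φ : S →+* AlgebraicClosure (PlaneFoliation.ResField 𝔭),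
        φ.comp (algebraMap R S) = (algebraMap (PlaneFoliation.ResField 𝔭) _).comp
          (Ideal.Quotient.mk 𝔭.asIdeal) := by
  have hfp : (algebraMap R S).FinitePresentation := by
    rw [RingHom.finitePresentation_algebraMap]
    exact Algebra.FinitePresentation.of_finiteType.1 inferInstance
  obtain ⟨f, hf0, hf⟩ := PrimeSpectrum.exists_basicOpen_subset_of_isConstructible
    (PrimeSpectrum.isConstructible_range_comap hfp)
    ⟨⟨⊥, Ideal.isPrime_bot⟩, by
      ext1
      exact Ideal.comap_bot_of_injective _ (FaithfulSMul.algebraMap_injective R S)⟩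
  refine ⟨f, hf0, fun 𝔭 hp => ?_⟩
  obtain ⟨𝔮, hq⟩ := hf (show (⟨𝔭.asIdeal, 𝔭.isMaximal.isPrime⟩ : PrimeSpectrum R) ∈ _ from hp)
  -- Enlarging `𝔮` to a maximal ideal keeps it over `𝔭`, which is itself maximal. By the
  -- Nullstellensatz `S ⧸ 𝔫` is then finite over the residue field, so it embeds in the algebraic
  -- closure.
  obtain ⟨𝔫, h𝔫, hle⟩ := Ideal.exists_le_maximal 𝔮.asIdeal 𝔮.2.ne_top
  have hq' : 𝔮.asIdeal.comap (algebraMap R S) = 𝔭.asIdeal := congrArg (·.asIdeal) hq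
  have : 𝔫.LiesOver 𝔭.asIdeal := ⟨𝔭.isMaximal.eq_of_le (Ideal.comap_ne_top _ h𝔫.ne_top)
    (hq' ▸ Ideal.comap_mono hle)⟩
  let : Field (S ⧸ 𝔫) := Ideal.Quotient.field 𝔫
  have : Algebra.FiniteType R (S ⧸ 𝔫) := Algebra.FiniteType.trans (S := S) inferInstance inferInstance
  have : Algebra.FiniteType (R ⧸ 𝔭.asIdeal) (S ⧸ 𝔫) :=
    Algebra.FiniteType.of_restrictScalars_finiteType R _ _
  have : Module.Finite (PlaneFoliation.ResField 𝔭) (S ⧸ 𝔫) :=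
    finite_of_finite_type_of_isJacobsonRing (PlaneFoliation.ResField 𝔭) (S ⧸ 𝔫)
  let ψ : S ⧸ 𝔫 →ₐ[PlaneFoliation.ResField 𝔭] AlgebraicClosure (PlaneFoliation.ResField 𝔭) :=
    IsAlgClosed.lift
  refine ⟨ψ.toRingHom.comp (Ideal.Quotient.mk 𝔫), RingHom.ext fun r => ?_⟩
  exact ψ.commutes (Ideal.Quotient.mk _ r)

instance Int.isJacobsonRing : IsJacobsonRing ℤ := by
  refine isJacobsonRing_iff_prime_eq.2 fun P hP => ?_
  by_cases hb : P = ⊥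
  · subst hb
    refine le_antisymm (fun x hx => ?_) Ideal.le_jacobson
    by_contra hx0
    obtain ⟨p, hle, hp⟩ := Nat.exists_infinite_primes (x.natAbs + 1)
    have hp' : Prime (p : ℤ) := Nat.prime_iff_prime_int.1 hp
    have hmax : (Ideal.span {(p : ℤ)}).IsMaximal :=
      PrincipalIdealRing.isMaximal_of_irreducible hp'.irreducible
    have hmem := Ideal.mem_sInf.1 hx ⟨bot_le, hmax⟩
    rw [Ideal.mem_span_singleton] at hmem
    have := Nat.le_of_dvd (Int.natAbs_pos.2 hx0) (Int.natCast_dvd.1 hmem)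
    omega
  · have := hP.isMaximal hb
    exact Ideal.jacobson_eq_self_of_isMaximal

/-- In a Jacobson domain the maximal ideals intersect in zero, so the open set `f ≠ 0` has a closed
point and meets every dense set. -/
theorem MaximalSpectrum.exists_mem_of_dense {R : Type*} [CommRing R] [IsDomain R]
    [IsJacobsonRing R] {s : Set (MaximalSpectrum R)} (hs : Dense s) {f : R} (hf : f ≠ 0) :
    ∃ 𝔭 ∈ s, f ∉ 𝔭.asIdeal := by
  have hne : ({𝔭 : MaximalSpectrum R | f ∉ 𝔭.asIdeal}).Nonempty := by
    have hj : (⊥ : Ideal R).jacobson = ⊥ :=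
      IsJacobsonRing.out ‹_› Ideal.isPrime_bot.isRadical
    by_contra hcon
    refine hf (Ideal.mem_bot.1 (hj ▸ Ideal.mem_sInf.2 fun {J} hJ => ?_))
    by_contra h
    exact hcon ⟨⟨J, hJ.2⟩, h⟩
  have hopen : IsOpen {𝔭 : MaximalSpectrum R | f ∉ 𝔭.asIdeal} :=
    (PrimeSpectrum.basicOpen f).isOpen.preimage MaximalSpectrum.toPrimeSpectrum_continuous
  obtain ⟨𝔭, h, h'⟩ := hs.inter_open_nonempty _ hopen hne
  exact ⟨𝔭, h', h⟩

/-! ### Reduction of invariant curves and conclusion -/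

namespace PlaneFoliation

theorem wedge_differential_map {R S : Type*} [CommRing R] [CommRing S] (φ : R →+* S) (F : Poly R)
    (ω : OneForm R) (i : Fin 3) :
    wedge (differential (map φ F)) (fun j => map φ (ω j)) i =
      map φ (wedge (differential F) ω i) := by
  fin_cases i <;> simp [wedge, differential, pderiv_map]

instance finiteType_coeffRing (ω : OneForm ℂ) : Algebra.FiniteType ℤ (coeffRing ω) := by
  rw [← Subalgebra.fg_iff_finiteType, coeffRing]
  have hfin : ({c : ℂ | ∃ (i : Fin 3) (m : Fin 3 →₀ ℕ), c = coeff m (ω i)}).Finite := by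
    refine ((Set.finite_iUnion fun i =>
      ((ω i).support.finite_toSet.image fun m => coeff m (ω i))).insert 0).subset ?_
    rintro c ⟨i, m, rfl⟩
    by_cases h : coeff m (ω i) = 0
    · exact Or.inl h
    · exact Or.inr (Set.mem_iUnion.2 ⟨i, m, by simpa using h, rfl⟩)
  exact ⟨hfin.toFinset, by simp⟩

/-- An invariant curve of a complex foliation reduces to an invariant curve of the same degree,
modulo all primes in a nonempty open set. -/
theorem exists_invariant_reduction {d e : ℕ} {ω : OneForm ℂ} {F : Poly ℂ}
    (hF : F.IsHomogeneous e) (hF0 : F ≠ 0) (hinv : IsInvariant d ω F) :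
    ∃ f : coeffRing ω, f ≠ 0 ∧ ∀ 𝔭 : MaximalSpectrum (coeffRing ω), f ∉ 𝔭.asIdeal →
      ∃ G : Poly (AlgebraicClosure (ResField 𝔭)), G.IsHomogeneous e ∧ G ≠ 0 ∧
        ∀ i, G ∣ wedge (differential G) (reduction ω 𝔭) i := by
  obtain ⟨Θ, -, hΘ⟩ := hinv
  obtain ⟨m, hm⟩ := ne_zero_iff.1 hF0
  -- Inverting one nonzero coefficient of `F` keeps every specialization of `F` nonzero.
  let T : Set ℂ := insert (coeff m F)⁻¹ (F.coeffs ∪ ⋃ i, (Θ i).coeffs)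
  have hT : T.Finite := ((F.coeffs.finite_toSet.union
    (Set.finite_iUnion fun i => (Θ i).coeffs.finite_toSet)).insert _)
  let S : Subalgebra (coeffRing ω) ℂ := Algebra.adjoin (coeffRing ω) T
  have : Algebra.FiniteType (coeffRing ω) S :=
    (Subalgebra.fg_iff_finiteType _).1 ⟨hT.toFinset, by simp [S]⟩
  have : IsNoetherianRing (coeffRing ω) := Algebra.FiniteType.isNoetherianRing ℤ _
  have hTS {c : ℂ} (hc : c ∈ T) : c ∈ S := Algebra.subset_adjoin hc
  have lift {P : Poly ℂ} (hP : ∀ c ∈ P.coeffs, c ∈ T) : ∃ Q : Poly S, map S.val.toRingHom Q = P := by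
    refine mem_range_map_iff_coeffs_subset.2 ?_
    exact fun c hc => ⟨⟨c, hTS (hP c hc)⟩, rfl⟩
  obtain ⟨F', hF'⟩ := lift (P := F) fun c hc => Or.inr (Or.inl hc)
  choose Θ' hΘ' using fun i => lift (P := Θ i) fun c hc => Or.inr (Or.inr (Set.mem_iUnion.2 ⟨i, hc⟩))
  have hinj : Function.Injective (map (σ := Fin 3) S.val.toRingHom) :=
    map_injective _ Subtype.val_injective
  have hω (i : Fin 3) : map S.val.toRingHom (map (algebraMap (coeffRing ω) S) (integralModel ω i))
      = ω i := by
    rw [map_map]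
    exact map_integralModel ω i
  have hwedge (i : Fin 3) : wedge (differential F')
      (fun j => map (algebraMap (coeffRing ω) S) (integralModel ω j)) i = F' * Θ' i := by
    apply hinj
    rw [← wedge_differential_map, map_mul, hF', hΘ', ← hΘ]
    simp only [hω]
  have hRS : FaithfulSMul (coeffRing ω) S := by
    rw [faithfulSMul_iff_algebraMap_injective]
    intro a b hab
    exact Subtype.val_injective (congrArg (fun s : S => (s : ℂ)) hab)
  obtain ⟨f, hf0, hf⟩ := exists_ne_zero_forall_exists_ringHom_algebraicClosure
    (R := coeffRing ω) (S := S)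
  refine ⟨f, hf0, fun 𝔭 hp => ?_⟩
  obtain ⟨φ, hφ⟩ := hf 𝔭 hp
  have hred : reduction ω 𝔭 =
      fun j => map φ (map (algebraMap (coeffRing ω) S) (integralModel ω j)) := by
    funext j
    rw [map_map, hφ]
    rfl
  have hFh : F'.IsHomogeneous e := by
    intro n hn
    refine hF fun h => hn (Subtype.val_injective ?_)
    rw [← hF', coeff_map] at h
    exact h
  refine ⟨map φ F', fun n hn => hFh fun h => hn (by rw [coeff_map, h, map_zero]), ?_, fun i => ?_⟩
  · refine ne_zero_iff.2 ⟨m, ?_⟩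
    rw [coeff_map]
    have hu : coeff m F' * ⟨(coeff m F)⁻¹, hTS (Or.inl rfl)⟩ = 1 := by
      apply Subtype.val_injective
      have : ((coeff m F' : S) : ℂ) = coeff m F := by rw [← hF', coeff_map]; rfl
      simp [this, hm]
    exact left_ne_zero_of_mul_eq_one (by rw [← map_mul, hu, map_one])
  · rw [hred, wedge_differential_map, hwedge, map_mul]
    exact dvd_mul_right _ _

end PlaneFoliation

theorem mainTheorem7 (d : ℕ) (hd : 1 < d) (ω : PlaneFoliation.OneForm ℂ)
    (hω : PlaneFoliation.IsFoliation d ω)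
    (hirr : PlaneFoliation.ForInfinitelyManyPrimes
      (fun 𝔭 : MaximalSpectrum (PlaneFoliation.coeffRing ω) =>
        PlaneFoliation.HasIrreduciblePDivisor d (PlaneFoliation.reduction ω 𝔭))) :
    ¬ PlaneFoliation.HasAlgebraicSolution d ω := by
  open PlaneFoliation in
  rintro ⟨e, F, hF, hFirr, hinv⟩
  have he : 0 < e := by
    refine Nat.pos_of_ne_zero fun h => hFirr.not_isUnit ?_
    subst h
    have hC := totalDegree_eq_zero_iff_eq_C.1 (hF.totalDegree hFirr.ne_zero)
    rw [hC]
    refine (isUnit_iff_ne_zero.2 fun h0 => hFirr.ne_zero ?_).map C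
    rw [hC, h0, C_0]
  obtain ⟨f, hf0, hf⟩ := exists_invariant_reduction hF hFirr.ne_zero hinv
  obtain ⟨s, hs, hirr⟩ := hirr
  have : IsJacobsonRing (coeffRing ω) := isJacobsonRing_of_finiteType (A := ℤ)
  -- Avoiding `e!` forces the residue characteristic above `e`.
  have hfe : f * (e.factorial : coeffRing ω) ≠ 0 :=
    mul_ne_zero hf0 (Nat.cast_ne_zero.2 e.factorial_ne_zero)
  obtain ⟨𝔭, hps, hp⟩ := MaximalSpectrum.exists_mem_of_dense hs hfe
  obtain ⟨G, hG, hG0, hGinv⟩ := hf 𝔭 fun h => hp (Ideal.mul_mem_right _ _ h)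
  have hcoef (i : Fin 3) : (integralModel ω i).IsHomogeneous (d + 1) := by
    intro n hn
    refine hω.isHomogeneous i fun h => hn (Subtype.val_injective ?_)
    rw [← map_integralModel ω i, coeff_map] at h
    exact h
  have hrad : ∑ i, integralModel ω i * X i = 0 := by
    apply map_injective (coeffRing ω).val.toRingHom Subtype.val_injective
    simp only [map_sum, map_mul, map_integralModel, map_X, map_zero]
    exact hω.contract_radial
  have hr : ∑ i, reduction ω 𝔭 i * X i = 0 := by
    simpa [reduction] using congrArg (map ((algebraMap (ResField 𝔭)
      (AlgebraicClosure (ResField 𝔭))).comp (Ideal.Quotient.mk 𝔭.asIdeal))) hrad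
  have h := hirr 𝔭 hps
  refine h.not_invariant hd (fun i n hn => hcoef i fun h => hn ?_) hr he ?_ hG hG0 hGinv
  · rw [reduction, coeff_map, h, map_zero]
  · by_contra hle
    have hdvd := (h.prime_ringChar hr).dvd_factorial.2 (not_lt.1 hle)
    refine hp (Ideal.mul_mem_left _ _ ?_)
    rw [← Ideal.Quotient.eq_zero_iff_mem, map_natCast]
    apply (algebraMap (ResField 𝔭) (AlgebraicClosure (ResField 𝔭))).injective
    rw [map_zero]
    exact (map_natCast _ _).trans ((ringChar.spec _ _).2 hdvd)
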